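/- Let $X$ be a compactly generated Hausdorff path-connected space with basepoint $x_0$, let $X^X$ be the space of continuous maps $X\to X$ and $\mathrm{ev}: X^X\to X$, $f\mapsto f(x_0)$, the evaluation map. For $n\ge 1$ and a space $Y$ with basepoint $y_0$, let $\tau_n(Y,y_0)$ denote the $n$-th torus homotopy group of Fox, that is, the fundamental group of the space $Y^{T^{n-1}}$ of all continuous maps from the $(n-1)$-dimensional torus $T^{n-1}=(S^1)^{n-1}$ to $Y$, based at the constant map with value $y_0$. Let $$G_n(X)=\mathrm{Im}\big(\mathrm{ev}_*:\pi_n(X^X,1_X)\to\pi_n(X,x_0)\big),\qquad G\tau_n(X)=\mathrm{Im}\big(\mathrm{ev}_*:\tau_n(X^X,1_X)\to\tau_n(X,x_0)\big)$$ be the $n$-th Gottlieb group and the $n$-th Gottlieb–Fox group of $X$. Then $X$ is a Gottlieb space, i.e. $G_n(X)=\pi_n(X,x_0)$ for all $n\ge 1$, if and only if $X$ is a Gottlieb–Fox space, i.e. $G\tau_n(X)=\tau_n(X,x_0)$ for all $n\ge 1$. -/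

import Mathlib

open scoped Topology Topology.Homotopy unitInterval

noncomputable section

namespace GottliebFox

variable {X Y : Type*} [TopologicalSpace X] [TopologicalSpace Y]

/-- Composition of an `N`-dimensional loop in `X` at `x` with a continuous map `f : X → Y`
such that `f x = y`. -/
def genLoopMap (N : Type*) (f : C(X, Y)) {x : X} {y : Y} (h : f x = y) (p : GenLoop N X x) :
    GenLoop N Y y :=
  ⟨f.comp p.1, fun t ht => (congrArg f (p.2 t ht)).trans h⟩

theorem genLoopMap_homotopic {N : Type*} (f : C(X, Y)) {x : X} {y : Y} (h : f x = y)
    {p q : GenLoop N X x} (hpq : GenLoop.Homotopic p q) :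
    GenLoop.Homotopic (genLoopMap N f h p) (genLoopMap N f h q) :=
  hpq.comp_continuousMap f

/-- The map of homotopy groups induced by a continuous map `f : X → Y` such that `f x = y`. -/
def homotopyGroupMapFun (N : Type*) (f : C(X, Y)) {x : X} {y : Y} (h : f x = y) :
    HomotopyGroup N X x → HomotopyGroup N Y y :=
  Quotient.map (genLoopMap N f h) fun _ _ hpq => genLoopMap_homotopic f h hpq

/-- The homomorphism of homotopy groups induced by a continuous map `f : X → Y` such that
`f x = y`. -/
def homotopyGroupMap (N : Type*) [DecidableEq N] [Nonempty N] (f : C(X, Y)) {x : X} {y : Y}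
    (h : f x = y) : HomotopyGroup N X x →* HomotopyGroup N Y y :=
  MonoidHom.mk' (homotopyGroupMapFun N f h) (by
    rintro ⟨p⟩ ⟨q⟩
    let i : N := Classical.arbitrary N
    refine (congrArg (homotopyGroupMapFun N f h)
      (HomotopyGroup.mul_spec (i := i) (p := p) (q := q))).trans ?_
    refine Eq.trans ?_
      (HomotopyGroup.mul_spec (i := i) (p := genLoopMap N f h p) (q := genLoopMap N f h q)).symm
    refine congrArg (Quotient.mk _) (Subtype.ext (ContinuousMap.ext fun t => ?_))
    exact apply_ite f _ _ _)

/-- The torus homotopy group `τ_n(X, x)` (for `n ≥ 1`): the fundamental group of the space of all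
(not necessarily pointed) continuous maps from the `(n - 1)`-dimensional torus to `X`, with the
compact-open topology, based at the constant map with value `x`. -/
abbrev TorusHomotopyGroup (n : ℕ) (X : Type*) [TopologicalSpace X] (x : X) : Type _ :=
  FundamentalGroup C(UnitAddTorus (Fin (n - 1)), X)
    (ContinuousMap.const (UnitAddTorus (Fin (n - 1))) x)

/-- Composition with a continuous map `f : X → Y`, as a continuous map `X^T → Y^T`. -/
def postcomp (T : Type*) [TopologicalSpace T] (f : C(X, Y)) : C(C(T, X), C(T, Y)) :=
  ⟨fun g => f.comp g, f.continuous_postcomp⟩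

/-- The homomorphism of torus homotopy groups induced by a continuous map `f : X → Y` such that
`f x = y`. -/
def torusHomotopyGroupMap (n : ℕ) (f : C(X, Y)) {x : X} {y : Y} (h : f x = y) :
    TorusHomotopyGroup n X x →* TorusHomotopyGroup n Y y :=
  FundamentalGroup.mapOfEq (postcomp (UnitAddTorus (Fin (n - 1))) f)
    (ContinuousMap.ext fun _ => h)

/-- The evaluation map `X^X → X`, `g ↦ g x₀`. -/
def ev (x₀ : X) : C(C(X, X), X) :=
  ⟨fun g => g x₀, continuous_eval_const x₀⟩

theorem ev_id (x₀ : X) : ev x₀ (ContinuousMap.id X) = x₀ := rfl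

/-- The Gottlieb group `G_n(X, x₀)` (for `n ≥ 1`): the image of
`ev_* : π_n(X^X, 1_X) → π_n(X, x₀)`. -/
def gottliebGroup (n : ℕ) [Nonempty (Fin n)] (X : Type*) [TopologicalSpace X] (x₀ : X) :
    Subgroup (HomotopyGroup.Pi n X x₀) :=
  (homotopyGroupMap (Fin n) (ev x₀) (ev_id x₀)).range

/-- The Gottlieb–Fox group `Gτ_n(X, x₀)` (for `n ≥ 1`): the image of
`ev_* : τ_n(X^X, 1_X) → τ_n(X, x₀)`. -/
def gottliebFoxGroup (n : ℕ) (X : Type*) [TopologicalSpace X] (x₀ : X) :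
    Subgroup (TorusHomotopyGroup n X x₀) :=
  (torusHomotopyGroupMap n (ev x₀) (ev_id x₀)).range

/-- `(X, x₀)` is a Gottlieb space: `G_n(X, x₀) = π_n(X, x₀)` for all `n ≥ 1`. -/
def IsGottlieb (X : Type*) [TopologicalSpace X] (x₀ : X) : Prop :=
  ∀ n : ℕ, gottliebGroup (n + 1) X x₀ = ⊤

/-- `(X, x₀)` is a Gottlieb–Fox space: `Gτ_n(X, x₀) = τ_n(X, x₀)` for all `n ≥ 1`. -/
def IsGottliebFox (X : Type*) [TopologicalSpace X] (x₀ : X) : Prop :=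
  ∀ n : ℕ, gottliebFoxGroup (n + 1) X x₀ = ⊤

end GottliebFox

end

/-! Both conditions say that evaluation is surjective on certain homotopy groups, and the
equivalence holds for any continuous map `p : A → B` with a base point `a`. A class in τ_{n+1}(B) is
given by a map on I × Iⁿ that sends the ends of the first (loop) coordinate to the base point and is
periodic in the other n coordinates. For π_{n+1}(B) the other coordinates are "boxed" instead: their
ends too go to the base point. `Shape.cube` interpolates by allowing any set `P` of periodic
coordinates, and `Shape.Lifts` is surjectivity of `p` on homotopy classes of such maps.

Making a boxed coordinate t periodic turns the group into a split extension. Restriction to the edge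
t = 0 is split by the maps independent of t, and its kernel consists of the classes with t boxed.
Concretely, `fold f` is a boxed representative of f · e⁻¹, where e is the edge of f; gluing e back
recovers f (`homotopic_glue_fold`), and on boxed maps `fold` is homotopic to the identity
(`homotopic_fold_of_box`). Both operations commute with composition with `p`. Hence lifting with t
periodic is equivalent to lifting with t boxed together with lifting with t omitted
(`cube_insert_lifts_iff`).

Induction on the dimension and on `P` leads from no periodic coordinates to all of them; boxing the
coordinates one at a time leads back (`forall_lifts_iff`). -/

noncomputable section

namespace GottliebFox

-- Admissible maps, lifting up to homotopy, and passage to quotients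

universe u

/-- A subset `S` of `K`, to be sent to the base point, and a relation `r` on `K`, to be respected
by maps out of `K`. -/
structure Shape (K : Type*) where
  S : Set K
  r : K → K → Prop

namespace Shape

variable {K K' : Type*}

/-- The map `f` sends `Λ.S` to the base point `b` and respects `Λ.r`. -/
structure Adm {Z : Type*} (Λ : Shape K) (b : Z) (f : K → Z) : Prop where
  base : ∀ x ∈ Λ.S, f x = b
  rel : ∀ x y, Λ.r x y → f x = f y

theorem Adm.comp {Z W : Type*} {Λ : Shape K} {b : Z} {f : K → Z} (h : Λ.Adm b f) (p : Z → W) :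
    Λ.Adm (p b) (fun x => p (f x)) :=
  ⟨fun x hx => congrArg p (h.base x hx), fun x y hxy => congrArg p (h.rel x y hxy)⟩

theorem Adm.eq_of_eqvGen {Z : Type*} {Λ : Shape K} {b : Z} {f : K → Z} (h : Λ.Adm b f) {x y : K}
    (hxy : Relation.EqvGen Λ.r x y) : f x = f y := by
  induction hxy with
  | rel x y h' => exact h.rel x y h'
  | refl => rfl
  | symm _ _ _ ih => exact ih.symm
  | trans _ _ _ _ _ ih ih' => exact ih.trans ih'

/-- The shape on `I × K` of loops of admissible maps on `K` based at the constant map. -/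
def susp (Λ : Shape K) : Shape (I × K) where
  S := {x | x.1 = 0 ∨ x.1 = 1 ∨ x.2 ∈ Λ.S}
  r x y := x.1 = y.1 ∧ Λ.r x.2 y.2

/-- The shape on `K × I` of admissible maps on `K` with an additional periodic coordinate. -/
def periodic (Λ : Shape K) : Shape (K × I) where
  S := {x | x.1 ∈ Λ.S}
  r x y := (x.2 = y.2 ∧ Λ.r x.1 y.1) ∨ (x.1 = y.1 ∧ x.2 = 0 ∧ y.2 = 1)

/-- The shape on `K × I` of admissible maps on `K` with an additional coordinate at whose end
points the maps take the base point as value. -/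
def box (Λ : Shape K) : Shape (K × I) where
  S := {x | x.1 ∈ Λ.S ∨ x.2 = 0 ∨ x.2 = 1}
  r x y := x.2 = y.2 ∧ Λ.r x.1 y.1

/-- The map `q` identifies the shape `Λ` with the quotient of the shape `Λ'`. -/
structure IsQuotient (Λ' : Shape K') (Λ : Shape K) (q : K' → K) : Prop where
  mem_iff : ∀ x, x ∈ Λ'.S ↔ q x ∈ Λ.S
  map_rel : ∀ x y, Λ'.r x y → q x = q y ∨ Λ.r (q x) (q y)
  lift_rel : ∀ x y, Λ.r x y → ∃ x' y', q x' = x ∧ q y' = y ∧ Λ'.r x' y'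
  ker : ∀ x y, q x = q y → Relation.EqvGen Λ'.r x y

theorem IsQuotient.susp {Λ' : Shape K'} {Λ : Shape K} {q : K' → K} (h : IsQuotient Λ' Λ q) :
    IsQuotient Λ'.susp Λ.susp (Prod.map id q) where
  mem_iff x := by simp [Shape.susp, h.mem_iff]
  map_rel := by
    rintro ⟨s, x⟩ ⟨t, y⟩ ⟨hst, hxy⟩
    obtain rfl : s = t := hst
    rcases h.map_rel x y hxy with h | h
    · left; simp [h]
    · right; exact ⟨rfl, h⟩
  lift_rel := by
    rintro ⟨s, x⟩ ⟨t, y⟩ ⟨hst, hxy⟩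
    obtain rfl : s = t := hst
    obtain ⟨x', y', rfl, rfl, h'⟩ := h.lift_rel x y hxy
    exact ⟨(s, x'), (s, y'), rfl, rfl, rfl, h'⟩
  ker := by
    rintro ⟨s, x⟩ ⟨t, y⟩ hst
    obtain ⟨h1, h2⟩ := Prod.ext_iff.1 hst
    obtain rfl : s = t := h1
    have := h.ker x y h2
    clear h2 hst
    induction this with
    | rel x y h => exact .rel _ _ ⟨rfl, h⟩
    | refl x => exact .refl _
    | symm _ _ _ ih => exact .symm _ _ ih
    | trans _ _ _ _ _ ih ih' => exact .trans _ _ _ ih ih'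

section

variable {Λ' : Shape K'} {Λ : Shape K} {q : K' → K}

theorem IsQuotient.adm_comp {Z : Type*} (h : IsQuotient Λ' Λ q) {b : Z} {f : K → Z}
    (hf : Λ.Adm b f) : Λ'.Adm b (fun x => f (q x)) :=
  ⟨fun x hx => hf.base _ ((h.mem_iff x).1 hx), fun x y hxy =>
    (h.map_rel x y hxy).elim (congrArg f) (hf.rel _ _)⟩

theorem IsQuotient.adm_of_comp {Z : Type*} (h : IsQuotient Λ' Λ q) (hq : q.Surjective) {b : Z}
    {f : K → Z} (hf : Λ'.Adm b (fun x => f (q x))) : Λ.Adm b f where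
  base x hx := by
    obtain ⟨x, rfl⟩ := hq x
    exact hf.base x ((h.mem_iff x).2 hx)
  rel x y hxy := by
    obtain ⟨x, y, rfl, rfl, h'⟩ := h.lift_rel x y hxy
    exact hf.rel x y h'

end

variable [TopologicalSpace K] [TopologicalSpace K']

/-- Homotopy through admissible maps. -/
def Homotopic {B : Type*} [TopologicalSpace B] (Λ : Shape K) (b : B) (f g : C(K, B)) : Prop :=
  f.HomotopicWith g fun h => Λ.Adm b h

section

variable {B : Type*} [TopologicalSpace B] {Λ : Shape K} {b : B} {f g : C(K, B)}

theorem Homotopic.intro (F : I × K → B) (hF : Continuous F) (h0 : ∀ x, F (0, x) = f x)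
    (h1 : ∀ x, F (1, x) = g x) (h : ∀ u, Λ.Adm b fun x => F (u, x)) : Λ.Homotopic b f g :=
  ⟨⟨⟨⟨F, hF⟩, h0, h1⟩, h⟩⟩

theorem Homotopic.elim (h : Λ.Homotopic b f g) :
    ∃ F : I × K → B, Continuous F ∧ (∀ x, F (0, x) = f x) ∧ (∀ x, F (1, x) = g x) ∧
      ∀ u, Λ.Adm b fun x => F (u, x) :=
  let ⟨F⟩ := h
  ⟨F, F.continuous, F.apply_zero, F.apply_one, F.prop'⟩

theorem Homotopic.trans {h : C(K, B)} (hfg : Λ.Homotopic b f g) (hgh : Λ.Homotopic b g h) :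
    Λ.Homotopic b f h :=
  ContinuousMap.HomotopicWith.trans hfg hgh

end

/-- Every admissible map into `B` is homotopic, through admissible maps, to one which lifts
along `p` to an admissible map into `A`. -/
def Lifts {A B : Type u} [TopologicalSpace A] [TopologicalSpace B] (Λ : Shape K) (p : C(A, B))
    (a : A) : Prop :=
  ∀ f : C(K, B), Λ.Adm (p a) f → ∃ g : C(K, A), Λ.Adm a g ∧ Λ.Homotopic (p a) (p.comp g) f

section

variable {Λ' : Shape K'} {Λ : Shape K} {q : K' → K}

/-- Properness makes `id × q` a closed map, hence a quotient map, for every parameter space `W`; a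
product of a mere quotient map with `W` could fail to be one. `W = I` handles homotopies, a point
handles single maps. -/
theorem IsQuotient.exists_desc {B W : Type*} [TopologicalSpace B] [TopologicalSpace W]
    (h : IsQuotient Λ' Λ q) (hq : q.Surjective) (hp : IsProperMap q) {b : B} {F : W × K' → B}
    (hF : Continuous F) (hadm : ∀ w, Λ'.Adm b fun x => F (w, x)) :
    ∃ G : W × K → B, Continuous G ∧ (∀ w x, G (w, q x) = F (w, x)) ∧
      ∀ w, Λ.Adm b fun x => G (w, x) := by
  have hG : ∀ w x, F (w, Function.surjInv hq (q x)) = F (w, x) := fun w x =>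
    (hadm w).eq_of_eqvGen (h.ker _ _ (Function.surjInv_eq hq _))
  have hquot : Topology.IsQuotientMap (Prod.map id q : W × K' → W × K) :=
    (isProperMap_id.prodMap hp).isClosedMap.isQuotientMap (continuous_id.prodMap hp.continuous)
      (Function.surjective_id.prodMap hq)
  refine ⟨fun x => F (x.1, Function.surjInv hq x.2), hquot.continuous_iff.2 ?_, hG,
    fun w => h.adm_of_comp hq ?_⟩
  · convert hF using 1
    exact funext fun x => hG x.1 x.2
  · convert hadm w using 1
    exact funext fun x => hG w x

theorem IsQuotient.exists_desc_map {B : Type*} [TopologicalSpace B]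
    (h : IsQuotient Λ' Λ q) (hq : q.Surjective) (hp : IsProperMap q) {b : B} {f : C(K', B)}
    (hadm : Λ'.Adm b f) : ∃ g : C(K, B), (∀ x, g (q x) = f x) ∧ Λ.Adm b g := by
  obtain ⟨G, hG, h1, h2⟩ := h.exists_desc (W := Unit) (F := fun x => f x.2) hq hp (by fun_prop)
    fun _ => hadm
  exact ⟨⟨fun x => G ((), x), by fun_prop⟩, h1 (), h2 ()⟩

/-- Composition with `q` matches admissible maps on both sides, and likewise admissible homotopies,
so a lifting problem and its solution can be moved either way. -/
theorem IsQuotient.lifts_iff {A B : Type u} [TopologicalSpace A] [TopologicalSpace B]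
    (h : IsQuotient Λ' Λ q) (hq : q.Surjective) (hp : IsProperMap q) (p : C(A, B)) (a : A) :
    Λ'.Lifts p a ↔ Λ.Lifts p a := by
  have hc := hp.continuous
  constructor
  · intro H f hf
    obtain ⟨g', hg', H'⟩ := H (f.comp ⟨q, hc⟩) (h.adm_comp hf)
    obtain ⟨g, hg, hga⟩ := h.exists_desc_map hq hp hg'
    obtain ⟨F, hF, h0, h1, hFa⟩ := H'.elim
    obtain ⟨G, hG, hGF, hGa⟩ := h.exists_desc hq hp hF hFa
    refine ⟨g, hga, .intro G hG ?_ ?_ hGa⟩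
    · refine hq.forall.2 fun x => ?_
      rw [hGF, h0]
      exact congrArg p (hg x).symm
    · refine hq.forall.2 fun x => ?_
      rw [hGF, h1]
      rfl
  · intro H f' hf'
    obtain ⟨f, hf, hfa⟩ := h.exists_desc_map hq hp hf'
    obtain ⟨g, hga, H'⟩ := H f hfa
    obtain ⟨F, hF, h0, h1, hFa⟩ := H'.elim
    refine ⟨g.comp ⟨q, hc⟩, h.adm_comp hga,
      .intro (fun x => F (x.1, q x.2)) (by fun_prop) (fun x => h0 _) (fun x => ?_)
        fun u => h.adm_comp (hFa u)⟩
    rw [h1, hf]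

end

end Shape

/-! ### Explicit formulas on the square: folding, gluing, unwinding -/

/-- The retraction of the real line onto the unit interval. -/
abbrev clamp (x : ℝ) : I :=
  Set.projIcc 0 1 zero_le_one x

theorem clamp_of_le_zero {x : ℝ} (h : x ≤ 0) : clamp x = 0 :=
  Set.projIcc_of_le_left _ h

theorem clamp_of_one_le {x : ℝ} (h : 1 ≤ x) : clamp x = 1 :=
  Set.projIcc_of_right_le _ h

theorem clamp_coe (x : I) : clamp x = x :=
  Set.projIcc_val _ x

theorem clamp_max_zero (x : ℝ) : clamp (max x 0) = clamp x := by
  rcases le_total x 0 with h | h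
  · rw [max_eq_right h, clamp_of_le_zero h, clamp_of_le_zero le_rfl]
  · rw [max_eq_left h]

/-- For `r = 1` the function rising from `0` to `1` on `[0, 1 / 3]` and falling back to `0` on
`[2 / 3, 1]`; for `r = 0` the constant `1` on the unit interval. -/
def ramp (r t : ℝ) : ℝ :=
  min 1 (min (1 - r + 3 * t) (1 - r + 3 * (1 - t)))

/-- After clamping, for `r = 1` the function rising from `0` to `1` on `[1 / 3, 2 / 3]`; for `r = 0`
the identity of the unit interval. -/
def stretch (r t : ℝ) : ℝ :=
  (1 + 2 * r) * t - r

@[fun_prop]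
theorem continuous_ramp {W : Type*} [TopologicalSpace W] {r t : W → ℝ} (hr : Continuous r)
    (ht : Continuous t) : Continuous fun w => ramp (r w) (t w) := by
  unfold ramp; fun_prop

@[fun_prop]
theorem continuous_stretch {W : Type*} [TopologicalSpace W] {r t : W → ℝ} (hr : Continuous r)
    (ht : Continuous t) : Continuous fun w => stretch (r w) (t w) := by
  unfold stretch; fun_prop

/-- Positivity of `stretch r t` gives 3t ≥ (1 + 2r)t > r, and the bound by 1 gives the same for 1 -
t. Thus the second coordinate moves only where the first runs over its full range. -/
theorem ramp_eq_one {r t : ℝ} (hr : 0 ≤ r) (hr' : r ≤ 1) (h0 : 0 < stretch r t)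
    (h1 : stretch r t < 1) : ramp r t = 1 := by
  unfold stretch at h0 h1
  have ht : 0 < t := by
    by_contra! h
    nlinarith
  have ht' : 0 < 1 - t := by
    by_contra! h
    nlinarith
  unfold ramp
  rw [min_eq_left]
  apply le_min <;> nlinarith

/-- Makes the cutoff 1 - r in `unwind` inactive at s = 1/4, where its two branches meet. -/
theorem one_sub_le_ramp {r : ℝ} (hr : 0 ≤ r) (t : I) : 1 - r ≤ ramp r t := by
  have := t.2.1
  have := t.2.2
  unfold ramp
  refine le_min ?_ (le_min ?_ ?_) <;> linarith

theorem ramp_zero_right {r : ℝ} (hr : 0 ≤ r) : ramp r 0 = 1 - r := by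
  unfold ramp
  rw [min_eq_right, min_eq_left] <;> norm_num
  · exact hr

theorem ramp_one_right {r : ℝ} (hr : 0 ≤ r) : ramp r 1 = 1 - r := by
  unfold ramp
  rw [min_eq_right, min_eq_right] <;> norm_num
  · exact hr

theorem ramp_zero_left (t : I) : ramp 0 t = 1 := by
  have := t.2.1
  have := t.2.2
  unfold ramp
  rw [min_eq_left]
  apply le_min <;> linarith

theorem stretch_zero_left (t : ℝ) : stretch 0 t = t := by
  unfold stretch; ring

section

variable {Z : Type*}

/-- The square obtained from a square `f`, periodic in the second coordinate, by connecting each of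
its horizontal sections to the base point along the edge `f · 0`, and by contracting the resulting
loop along the same edge. -/
def fold (f : I → I → Z) (s t : I) : Z :=
  if (s : ℝ) ≤ 1 / 2 then f (clamp (2 * s * ramp 1 t)) (clamp (stretch 1 t))
  else f (clamp ((2 - 2 * s) * ramp 1 t)) 0

/-- Concatenation, in the first coordinate, of a square with a path. -/
def glue (f : I → I → Z) (g : I → Z) (s t : I) : Z :=
  if (s : ℝ) ≤ 1 / 2 then f (clamp (2 * s)) t else g (clamp (2 * s - 1))

/-- A deformation of `glue (fold f) (f · 0)` to a reparametrization of `f`. -/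
def unwind (f : I → I → Z) (r s t : I) : Z :=
  if (s : ℝ) ≤ 1 / 4 then f (clamp (4 * s * ramp r t)) (clamp (stretch r t))
  else f (clamp (max (max ((2 - 4 * s) * ramp r t) (2 * s - 1)) (1 - r))) 0

variable {f : I → I → Z} {b : Z}

/-- Either the second coordinate is clamped to an end, where periodicity applies, or `ramp` is 1 and
both sides are the base point. This is the matching condition behind the continuity of `fold` and
`unwind`. -/
theorem apply_ramp_stretch (h1 : ∀ t, f 1 t = b) (hp : ∀ s, f s 0 = f s 1) (r : I) (t : ℝ) :
    f (clamp (ramp r t)) (clamp (stretch r t)) = f (clamp (ramp r t)) 0 := by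
  rcases le_or_gt (stretch r t) 0 with h | h
  · rw [clamp_of_le_zero h]
  rcases le_or_gt 1 (stretch r t) with h' | h'
  · rw [clamp_of_one_le h', hp]
  · rw [ramp_eq_one r.2.1 r.2.2 h h', clamp_of_one_le le_rfl, h1, h1]

theorem unwind_boundary (h1 : ∀ t, f 1 t = b) (hp : ∀ s, f s 0 = f s 1) (r s t : I)
    (hs : (s : ℝ) = 1 / 4) :
    f (clamp (4 * s * ramp r t)) (clamp (stretch r t)) =
      f (clamp (max (max ((2 - 4 * s) * ramp r t) (2 * s - 1)) (1 - r))) 0 := by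
  have h := one_sub_le_ramp r.2.1 t
  have hr := r.2.2
  rw [hs, show (4 * (1 / 4) : ℝ) = 1 by norm_num, one_mul, apply_ramp_stretch h1 hp,
    max_eq_left (a := (2 - 1) * _), show ((2 - 1) : ℝ) = 1 by norm_num, one_mul, max_eq_left h]
  linarith

theorem fold_boundary (h1 : ∀ t, f 1 t = b) (hp : ∀ s, f s 0 = f s 1) (s t : I)
    (hs : (s : ℝ) = 1 / 2) :
    f (clamp (2 * s * ramp 1 t)) (clamp (stretch 1 t)) = f (clamp ((2 - 2 * s) * ramp 1 t)) 0 := by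
  rw [hs]
  norm_num
  exact apply_ramp_stretch h1 hp 1 t

theorem glue_boundary {g : I → Z} (h1 : ∀ t, f 1 t = b) (hg : g 0 = b) (s t : I)
    (hs : (s : ℝ) = 1 / 2) : f (clamp (2 * s)) t = g (clamp (2 * s - 1)) := by
  rw [hs, clamp_of_one_le (by norm_num), clamp_of_le_zero (by norm_num), h1, hg]

theorem fold_zero_left (h0 : ∀ t, f 0 t = b) (t : I) : fold f 0 t = b := by
  simp [fold, h0]

theorem fold_one_left (h0 : ∀ t, f 0 t = b) (t : I) : fold f 1 t = b := by
  rw [fold, if_neg (by norm_num), clamp_of_le_zero (by simp), h0]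

theorem fold_zero_right (h0 : ∀ t, f 0 t = b) (s : I) : fold f s 0 = b := by
  have : ramp 1 0 = 0 := by simp [ramp]
  simp [fold, this, h0]

theorem fold_one_right (h0 : ∀ t, f 0 t = b) (s : I) : fold f s 1 = b := by
  have : ramp 1 1 = 0 := by simp [ramp]
  simp [fold, this, h0]

theorem fold_congr {g : I → I → Z} (h : ∀ s t, f s t = g s t) (s t : I) :
    fold f s t = fold g s t := by
  simp [fold, h]

theorem fold_const (h : ∀ s t, f s t = b) (s t : I) : fold f s t = b := by
  simp [fold, h]

theorem map_fold {W : Type*} (p : Z → W) (s t : I) :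
    p (fold f s t) = fold (fun s t => p (f s t)) s t :=
  apply_ite p _ _ _

theorem map_glue {W : Type*} (p : Z → W) (g : I → Z) (s t : I) :
    p (glue f g s t) = glue (fun s t => p (f s t)) (fun s => p (g s)) s t :=
  apply_ite p _ _ _

/-- If `f` is constant on the boundary of the square, then `fold f` is a reparametrization
of `f`. -/
theorem fold_of_boundary (h1 : ∀ t, f 1 t = b) (hs0 : ∀ s, f s 0 = b) (hs1 : ∀ s, f s 1 = b)
    (s t : I) : fold f s t = f (clamp (2 * s)) (clamp (stretch 1 t)) := by
  unfold fold
  split_ifs with hs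
  · rcases le_or_gt (stretch 1 t) 0 with h | h
    · rw [clamp_of_le_zero h, hs0, hs0]
    rcases le_or_gt 1 (stretch 1 t) with h' | h'
    · rw [clamp_of_one_le h', hs1, hs1]
    · rw [ramp_eq_one zero_le_one le_rfl h h', mul_one]
  · rw [hs0, clamp_of_one_le (x := 2 * s) (by linarith), h1]

/-- The edge is traversed backwards on [1/4, 1/2] and forwards on [1/2, 1]. The terms (2 - 4s) ·
ramp and 2s - 1 have opposite signs on either side of s = 1/2, so their maximum selects the right
one; at r = 1 the cutoff 1 - r is absorbed by clamping. -/
theorem glue_fold (s t : I) : glue (fold f) (fun s => f s 0) s t = unwind f 1 s t := by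
  have hr : 0 ≤ ramp 1 t := by simpa using one_sub_le_ramp zero_le_one t
  have hr' : ramp 1 t ≤ 1 := min_le_left _ _
  have hs := s.2.1
  have hs' := s.2.2
  unfold glue fold unwind
  rw [Set.Icc.coe_one, sub_self, clamp_max_zero]
  by_cases h : (s : ℝ) ≤ 1 / 2
  · have hc : (clamp (2 * s) : ℝ) = 2 * s :=
      congrArg Subtype.val (Set.projIcc_of_mem zero_le_one ⟨by linarith, by linarith⟩)
    rw [if_pos h, hc]
    by_cases h' : (s : ℝ) ≤ 1 / 4
    · rw [if_pos h', if_pos (by linarith)]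
      ring_nf
    · rw [if_neg h', if_neg (by linarith), max_eq_left]
      · ring_nf
      · have : 0 ≤ (2 - 4 * (s : ℝ)) * ramp 1 t := mul_nonneg (by linarith) hr
        linarith
  · rw [if_neg h, if_neg (by linarith), max_eq_right]
    have : (2 - 4 * (s : ℝ)) * ramp 1 t ≤ 0 := mul_nonpos_of_nonpos_of_nonneg (by linarith) hr
    linarith

theorem unwind_zero (h1 : ∀ t, f 1 t = b) (s t : I) : unwind f 0 s t = f (clamp (4 * s)) t := by
  unfold unwind
  simp only [Set.Icc.coe_zero, ramp_zero_left, stretch_zero_left, clamp_coe, mul_one]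
  split_ifs with h
  · rfl
  · rw [clamp_of_one_le, clamp_of_one_le, h1, h1]
    · linarith
    · simp

theorem unwind_zero_left (h0 : ∀ t, f 0 t = b) (r t : I) : unwind f r 0 t = b := by
  simp [unwind, h0]

theorem unwind_one_left (h1 : ∀ t, f 1 t = b) (r t : I) : unwind f r 1 t = b := by
  rw [unwind, if_neg (by norm_num), clamp_of_one_le, h1]
  exact le_max_of_le_left (le_max_of_le_right (by norm_num))

/-- `ramp r` takes the same value 1 - r at both ends, while `stretch r` is clamped to 0 and 1 there.
-/
theorem unwind_periodic (hp : ∀ s, f s 0 = f s 1) (r s : I) :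
    unwind f r s 0 = unwind f r s 1 := by
  have hr := r.2.1
  simp only [unwind, Set.Icc.coe_zero, Set.Icc.coe_one, ramp_zero_right hr, ramp_one_right hr]
  rw [clamp_of_le_zero (x := stretch r 0) (by simpa [stretch] using hr),
    clamp_of_one_le (x := stretch r 1) (by simp [stretch]; linarith), hp]

theorem unwind_congr {g : I → I → Z} (h : ∀ s t, f s t = g s t) (r s t : I) :
    unwind f r s t = unwind g r s t := by
  simp [unwind, h]

theorem unwind_const (h : ∀ s t, f s t = b) (r s t : I) : unwind f r s t = b := by
  simp [unwind, h]

theorem glue_zero_left (g : I → Z) (h0 : ∀ t, f 0 t = b) (t : I) : glue f g 0 t = b := by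
  simp [glue, h0]

theorem glue_one_left {g : I → Z} (hg : g 1 = b) (t : I) : glue f g 1 t = b := by
  rw [glue, if_neg (by norm_num), clamp_of_one_le (by norm_num), hg]

theorem glue_periodic (g : I → Z) (hp : ∀ s, f s 0 = f s 1) (s : I) :
    glue f g s 0 = glue f g s 1 := by
  simp [glue, hp]

theorem glue_congr {g : I → Z} {f' : I → I → Z} {g' : I → Z} (h : ∀ s t, f s t = f' s t)
    (h' : ∀ s, g s = g' s) (s t : I) : glue f g s t = glue f' g' s t := by
  simp [glue, h, h']

theorem glue_const {g : I → Z} (h : ∀ s t, f s t = b) (h' : ∀ s, g s = b) (s t : I) :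
    glue f g s t = b := by
  simp [glue, h, h']

end

/-! ### Continuity of the formulas in families -/

section

variable {W B : Type*} [TopologicalSpace W] [TopologicalSpace B] {b : B}

theorem continuous_fold {f : W → I → I → B} (hf : Continuous fun x : W × I × I => f x.1 x.2.1 x.2.2)
    (h1 : ∀ w t, f w 1 t = b) (hp : ∀ w s, f w s 0 = f w s 1) :
    Continuous fun x : W × I × I => fold (f x.1) x.2.1 x.2.2 := by
  refine Continuous.if_le ?_ ?_ (by fun_prop) (by fun_prop)
    fun x hx => fold_boundary (h1 x.1) (hp x.1) x.2.1 x.2.2 hx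
  · exact hf.comp (f := fun x : W × I × I =>
      (x.1, clamp (2 * x.2.1 * ramp 1 x.2.2), clamp (stretch 1 x.2.2))) (by fun_prop)
  · exact hf.comp (f := fun x : W × I × I =>
      (x.1, clamp ((2 - 2 * x.2.1) * ramp 1 x.2.2), (0 : I))) (by fun_prop)

theorem continuous_glue {f : W → I → I → B} {g : W → I → B}
    (hf : Continuous fun x : W × I × I => f x.1 x.2.1 x.2.2)
    (hg : Continuous fun x : W × I => g x.1 x.2) (h1 : ∀ w t, f w 1 t = b)
    (h0 : ∀ w, g w 0 = b) :
    Continuous fun x : W × I × I => glue (f x.1) (g x.1) x.2.1 x.2.2 := by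
  refine Continuous.if_le ?_ ?_ (by fun_prop) (by fun_prop)
    fun x hx => glue_boundary (h1 x.1) (h0 x.1) x.2.1 x.2.2 hx
  · exact hf.comp (f := fun x : W × I × I => (x.1, clamp (2 * x.2.1), x.2.2)) (by fun_prop)
  · exact hg.comp (f := fun x : W × I × I => (x.1, clamp (2 * x.2.1 - 1))) (by fun_prop)

theorem continuous_unwind {f : W → I → I → B}
    (hf : Continuous fun x : W × I × I => f x.1 x.2.1 x.2.2)
    (h1 : ∀ w t, f w 1 t = b) (hp : ∀ w s, f w s 0 = f w s 1) :
    Continuous fun x : W × I × I × I => unwind (f x.1) x.2.1 x.2.2.1 x.2.2.2 := by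
  refine Continuous.if_le ?_ ?_ (by fun_prop) (by fun_prop)
    fun x hx => unwind_boundary (h1 x.1) (hp x.1) x.2.1 x.2.2.1 x.2.2.2 hx
  · exact hf.comp (f := fun x : W × I × I × I => (x.1,
      clamp (4 * x.2.2.1 * ramp x.2.1 x.2.2.2), clamp (stretch x.2.1 x.2.2.2))) (by fun_prop)
  · exact hf.comp (f := fun x : W × I × I × I => (x.1,
      clamp (max (max ((2 - 4 * x.2.2.1) * ramp x.2.1 x.2.2.2) (2 * x.2.2.1 - 1)) (1 - x.2.1)),
      (0 : I))) (by fun_prop)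

end

/-! ### Splitting a periodic coordinate into a boxed part and an edge -/

namespace Shape

section

variable {K Z : Type*} {Λ : Shape K} {b : Z} {f : I × K × I → Z}

theorem Adm.periodic_of_box (h : Λ.box.susp.Adm b f) : Λ.periodic.susp.Adm b f where
  base := by
    rintro ⟨s, k, t⟩ (hs | hs | hk)
    exacts [h.base _ (.inl hs), h.base _ (.inr (.inl hs)), h.base _ (.inr (.inr (.inl hk)))]
  rel := by
    rintro ⟨s, k, t⟩ ⟨s', k', t'⟩ ⟨hs, hk | ⟨-, ht, ht'⟩⟩
    · exact h.rel _ _ ⟨hs, hk⟩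
    · exact (h.base _ (.inr (.inr (.inr (.inl ht))))).trans
        (h.base _ (.inr (.inr (.inr (.inr ht'))))).symm

theorem Adm.fold (h : Λ.periodic.susp.Adm b f) :
    Λ.box.susp.Adm b fun x => fold (fun s t => f (s, x.2.1, t)) x.1 x.2.2 := by
  have h0 : ∀ k t, f (0, k, t) = b := fun k t => h.base _ (.inl rfl)
  constructor
  · rintro ⟨s, k, t⟩ (hs | hs | hk | ht | ht)
    · obtain rfl : s = 0 := hs
      exact fold_zero_left (h0 k) t
    · obtain rfl : s = 1 := hs
      exact fold_one_left (h0 k) t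
    · exact fold_const (fun s t => h.base (s, k, t) (.inr (.inr hk))) s t
    · obtain rfl : t = 0 := ht
      exact fold_zero_right (h0 k) s
    · obtain rfl : t = 1 := ht
      exact fold_one_right (h0 k) s
  · rintro ⟨s, k, t⟩ ⟨s', k', t'⟩ ⟨hs, ht, hk⟩
    obtain rfl : s = s' := hs
    obtain rfl : t = t' := ht
    exact fold_congr (fun s t => h.rel (s, k, t) (s, k', t) ⟨rfl, .inl ⟨rfl, hk⟩⟩) s t

theorem Adm.glue {g : I × K → Z} (h : Λ.box.susp.Adm b f) (hg : Λ.susp.Adm b g) :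
    Λ.periodic.susp.Adm b fun x =>
      glue (fun s t => f (s, x.2.1, t)) (fun s => g (s, x.2.1)) x.1 x.2.2 := by
  constructor
  · rintro ⟨s, k, t⟩ (hs | hs | hk)
    · obtain rfl : s = 0 := hs
      exact glue_zero_left _ (fun t => h.base _ (.inl rfl)) t
    · obtain rfl : s = 1 := hs
      exact glue_one_left (hg.base _ (.inr (.inl rfl))) t
    · exact glue_const (fun s t => h.base (s, k, t) (.inr (.inr (.inl hk))))
        (fun s => hg.base (s, k) (.inr (.inr hk))) s t
  · rintro ⟨s, k, t⟩ ⟨s', k', t'⟩ ⟨hs, ⟨ht, hk⟩ | ⟨hk, ht, ht'⟩⟩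
    · obtain rfl : s = s' := hs
      obtain rfl : t = t' := ht
      exact glue_congr (fun s t => h.rel (s, k, t) (s, k', t) ⟨rfl, rfl, hk⟩)
        (fun s => hg.rel (s, k) (s, k') ⟨rfl, hk⟩) s t
    · obtain rfl : s = s' := hs
      obtain rfl : t = 0 := ht
      obtain rfl : t' = 1 := ht'
      obtain rfl : k = k' := hk
      exact glue_periodic _
        (fun s => h.periodic_of_box.rel (s, k, 0) (s, k, 1) ⟨rfl, .inr ⟨rfl, rfl, rfl⟩⟩) s

theorem Adm.unwind (h : Λ.periodic.susp.Adm b f) (r : I) :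
    Λ.periodic.susp.Adm b fun x => unwind (fun s t => f (s, x.2.1, t)) r x.1 x.2.2 := by
  constructor
  · rintro ⟨s, k, t⟩ (hs | hs | hk)
    · obtain rfl : s = 0 := hs
      exact unwind_zero_left (fun t => h.base _ (.inl rfl)) r t
    · obtain rfl : s = 1 := hs
      exact unwind_one_left (fun t => h.base _ (.inr (.inl rfl))) r t
    · exact unwind_const (fun s t => h.base (s, k, t) (.inr (.inr hk))) r s t
  · rintro ⟨s, k, t⟩ ⟨s', k', t'⟩ ⟨hs, ⟨ht, hk⟩ | ⟨hk, ht, ht'⟩⟩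
    · obtain rfl : s = s' := hs
      obtain rfl : t = t' := ht
      exact unwind_congr (fun s t => h.rel (s, k, t) (s, k', t) ⟨rfl, .inl ⟨rfl, hk⟩⟩) r s t
    · obtain rfl : s = s' := hs
      obtain rfl : t = 0 := ht
      obtain rfl : t' = 1 := ht'
      obtain rfl : k = k' := hk
      exact unwind_periodic (fun s => h.rel (s, k, 0) (s, k, 1) ⟨rfl, .inr ⟨rfl, rfl, rfl⟩⟩) r s

/-- Reparametrization preserving the end points of both intervals. -/
theorem Adm.reparam_periodic (h : Λ.periodic.susp.Adm b f) {α : I → I} (h0 : α 0 = 0)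
    (h1 : α 1 = 1) : Λ.periodic.susp.Adm b fun x => f (α x.1, x.2) := by
  constructor
  · rintro ⟨s, k, t⟩ (hs | hs | hk)
    · exact h.base _ (.inl ((congrArg α hs).trans h0))
    · exact h.base _ (.inr (.inl ((congrArg α hs).trans h1)))
    · exact h.base _ (.inr (.inr hk))
  · rintro ⟨s, k⟩ ⟨s', k'⟩ ⟨hs, hk⟩
    exact h.rel _ _ ⟨congrArg α hs, hk⟩

theorem Adm.reparam_box (h : Λ.box.susp.Adm b f) {α β : I → I} (h0 : α 0 = 0)
    (h1 : α 1 = 1) (h0' : β 0 = 0) (h1' : β 1 = 1) :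
    Λ.box.susp.Adm b fun x => f (α x.1, x.2.1, β x.2.2) := by
  constructor
  · rintro ⟨s, k, t⟩ (hs | hs | hk | ht | ht)
    · exact h.base _ (.inl ((congrArg α hs).trans h0))
    · exact h.base _ (.inr (.inl ((congrArg α hs).trans h1)))
    · exact h.base _ (.inr (.inr (.inl hk)))
    · exact h.base _ (.inr (.inr (.inr (.inl ((congrArg β ht).trans h0')))))
    · exact h.base _ (.inr (.inr (.inr (.inr ((congrArg β ht).trans h1')))))
  · rintro ⟨s, k, t⟩ ⟨s', k', t'⟩ ⟨hs, ht, hk⟩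
    exact h.rel _ _ ⟨congrArg α hs, congrArg β ht, hk⟩

theorem Adm.edge (h : Λ.periodic.susp.Adm b f) :
    Λ.susp.Adm b fun x => f (x.1, x.2, 0) := by
  constructor
  · rintro ⟨s, k⟩ (hs | hs | hk)
    exacts [h.base _ (.inl hs), h.base _ (.inr (.inl hs)), h.base _ (.inr (.inr hk))]
  · rintro ⟨s, k⟩ ⟨s', k'⟩ ⟨hs, hk⟩
    exact h.rel _ _ ⟨hs, .inl ⟨rfl, hk⟩⟩

/-- This is the section of restriction to the edge. -/
theorem Adm.cylinder {g : I × K → Z} (h : Λ.susp.Adm b g) :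
    Λ.periodic.susp.Adm b fun x => g (x.1, x.2.1) := by
  constructor
  · rintro ⟨s, k, t⟩ (hs | hs | hk)
    exacts [h.base _ (.inl hs), h.base _ (.inr (.inl hs)), h.base _ (.inr (.inr hk))]
  · rintro ⟨s, k, t⟩ ⟨s', k', t'⟩ ⟨hs, ⟨ht, hk⟩ | ⟨hk, ht, ht'⟩⟩
    · exact h.rel _ _ ⟨hs, hk⟩
    · exact congrArg g (Prod.ext hs hk)

end

variable {K B : Type*} [TopologicalSpace K] [TopologicalSpace B] {Λ : Shape K} {b : B}

theorem Adm.continuous_fold {W : Type*} [TopologicalSpace W] {F : W × I × K × I → B}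
    (hF : Continuous F) (h : ∀ w, Λ.periodic.susp.Adm b fun x => F (w, x)) :
    Continuous fun x : W × I × K × I =>
      GottliebFox.fold (fun s t => F (x.1, s, x.2.2.1, t)) x.2.1 x.2.2.2 := by
  have := GottliebFox.continuous_fold (b := b) (W := W × K)
    (f := fun w s t => F (w.1, s, w.2, t)) (by fun_prop)
    (fun w t => (h w.1).base (1, w.2, t) (.inr (.inl rfl)))
    (fun w s => (h w.1).rel (s, w.2, 0) (s, w.2, 1) ⟨rfl, .inr ⟨rfl, rfl, rfl⟩⟩)
  exact this.comp (f := fun x : W × I × K × I => ((x.1, x.2.2.1), x.2.1, x.2.2.2)) (by fun_prop)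

theorem Adm.continuous_glue {W : Type*} [TopologicalSpace W] {F : W × I × K × I → B}
    {G : W × I × K → B} (hF : Continuous F) (hG : Continuous G)
    (h : ∀ w, Λ.box.susp.Adm b fun x => F (w, x)) (h' : ∀ w, Λ.susp.Adm b fun x => G (w, x)) :
    Continuous fun x : W × I × K × I =>
      GottliebFox.glue (fun s t => F (x.1, s, x.2.2.1, t)) (fun s => G (x.1, s, x.2.2.1))
        x.2.1 x.2.2.2 := by
  have := GottliebFox.continuous_glue (b := b) (W := W × K)
    (f := fun w s t => F (w.1, s, w.2, t)) (g := fun w s => G (w.1, s, w.2)) (by fun_prop)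
    (by fun_prop)
    (fun w t => (h w.1).base (1, w.2, t) (.inr (.inl rfl)))
    (fun w => (h' w.1).base (0, w.2) (.inl rfl))
  exact this.comp (f := fun x : W × I × K × I => ((x.1, x.2.2.1), x.2.1, x.2.2.2)) (by fun_prop)

theorem Adm.continuous_unwind {f : I × K × I → B} (hf : Continuous f)
    (h : Λ.periodic.susp.Adm b f) :
    Continuous fun x : I × I × K × I =>
      GottliebFox.unwind (fun s t => f (s, x.2.2.1, t)) x.1 x.2.1 x.2.2.2 := by
  have := GottliebFox.continuous_unwind (b := b) (W := K)
    (f := fun k s t => f (s, k, t)) (by fun_prop)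
    (fun k t => h.base (1, k, t) (.inr (.inl rfl)))
    (fun k s => h.rel (s, k, 0) (s, k, 1) ⟨rfl, .inr ⟨rfl, rfl, rfl⟩⟩)
  exact this.comp (f := fun x : I × I × K × I => (x.2.2.1, x.1, x.2.1, x.2.2.2)) (by fun_prop)

/-- `fold` as an operation on admissible continuous maps. -/
def foldMap (f : C(I × K × I, B)) (h : Λ.periodic.susp.Adm b f) : C(I × K × I, B) where
  toFun x := fold (fun s t => f (s, x.2.1, t)) x.1 x.2.2
  continuous_toFun := (Adm.continuous_fold (W := Unit) (F := fun x => f x.2) (by fun_prop)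
    fun _ => h).comp (f := fun x : I × K × I => ((), x)) (by fun_prop)

/-- `glue` as an operation on admissible continuous maps. -/
def glueMap (f : C(I × K × I, B)) (g : C(I × K, B)) (h : Λ.box.susp.Adm b f)
    (h' : Λ.susp.Adm b g) : C(I × K × I, B) where
  toFun x := glue (fun s t => f (s, x.2.1, t)) (fun s => g (s, x.2.1)) x.1 x.2.2
  continuous_toFun := (Adm.continuous_glue (W := Unit) (F := fun x => f x.2) (G := fun x => g x.2)
    (by fun_prop) (by fun_prop) (fun _ => h) fun _ => h').comp
      (f := fun x : I × K × I => ((), x)) (by fun_prop)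

/-- Restriction of maps to the edge of a square. -/
def edgeMap (f : C(I × K × I, B)) : C(I × K, B) where
  toFun x := f (x.1, x.2, 0)

theorem Homotopic.fold {f g : C(I × K × I, B)} (h : Λ.periodic.susp.Homotopic b f g)
    (hf : Λ.periodic.susp.Adm b f) (hg : Λ.periodic.susp.Adm b g) :
    Λ.box.susp.Homotopic b (foldMap f hf) (foldMap g hg) :=
  let ⟨_, hF, h0, h1, ha⟩ := h.elim
  .intro _ (Adm.continuous_fold hF ha) (fun _ => fold_congr (fun _ _ => h0 _) _ _)
    (fun _ => fold_congr (fun _ _ => h1 _) _ _) fun u => (ha u).fold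

theorem Homotopic.glue {f f' : C(I × K × I, B)} {g g' : C(I × K, B)}
    (h : Λ.box.susp.Homotopic b f f') (h' : Λ.susp.Homotopic b g g') (hf : Λ.box.susp.Adm b f)
    (hf' : Λ.box.susp.Adm b f') (hg : Λ.susp.Adm b g) (hg' : Λ.susp.Adm b g') :
    Λ.periodic.susp.Homotopic b (glueMap f g hf hg) (glueMap f' g' hf' hg') :=
  let ⟨_, hF, h0, h1, ha⟩ := h.elim
  let ⟨_, hF', h0', h1', ha'⟩ := h'.elim
  .intro _ (Adm.continuous_glue hF hF' ha ha')
    (fun _ => glue_congr (fun _ _ => h0 _) (fun _ => h0' _) _ _)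
    (fun _ => glue_congr (fun _ _ => h1 _) (fun _ => h1' _) _ _) fun u => (ha u).glue (ha' u)

/-- The affine homotopy from the self-map `α` of the interval to the identity. -/
def toId (α : I → I) (u s : I) : I :=
  clamp ((1 - u) * α s + u * s)

theorem toId_zero (α : I → I) (s : I) : toId α 0 s = α s := by
  simp [toId]

theorem toId_one (α : I → I) (s : I) : toId α 1 s = s := by
  simp [toId]

theorem toId_left {α : I → I} (h : α 0 = 0) (u : I) : toId α u 0 = 0 := by
  simp [toId, h]

theorem toId_right {α : I → I} (h : α 1 = 1) (u : I) : toId α u 1 = 1 := by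
  simp [toId, h]

theorem continuous_toId {α : I → I} (h : Continuous α) :
    Continuous fun x : I × I => toId α x.1 x.2 := by
  unfold toId; fun_prop

/-- By `fold_of_boundary` the fold is a reparametrization fixing the ends of both intervals, and the
affine homotopy to the identity keeps those ends fixed. -/
theorem homotopic_fold_of_box {f : C(I × K × I, B)} (h : Λ.box.susp.Adm b f) :
    Λ.box.susp.Homotopic b (foldMap f h.periodic_of_box) f := by
  have hα := continuous_toId (α := fun s => clamp (2 * s)) (by fun_prop)
  have hβ := continuous_toId (α := fun t => clamp (stretch 1 t)) (by fun_prop)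
  refine .intro (fun x => f (toId (fun s => clamp (2 * s)) x.1 x.2.1, x.2.2.1,
    toId (fun t => clamp (stretch 1 t)) x.1 x.2.2.2)) (by fun_prop) ?_ ?_ ?_
  · rintro ⟨s, k, t⟩
    simp only [toId_zero]
    exact (fold_of_boundary (f := fun s t => f (s, k, t)) (fun t => h.base _ (.inr (.inl rfl)))
      (fun s => h.base _ (.inr (.inr (.inr (.inl rfl)))))
      (fun s => h.base _ (.inr (.inr (.inr (.inr rfl))))) s t).symm
  · rintro ⟨s, k, t⟩
    simp only [toId_one]
  · intro u
    exact h.reparam_box (toId_left (by simp) u) (toId_right (clamp_of_one_le (by norm_num)) u)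
      (toId_left (clamp_of_le_zero (by simp [stretch])) u)
      (toId_right (clamp_of_one_le (by norm_num [stretch])) u)

theorem homotopic_glue_fold {f : C(I × K × I, B)} (h : Λ.periodic.susp.Adm b f) :
    Λ.periodic.susp.Homotopic b (glueMap (foldMap f h) (edgeMap f) h.fold h.edge) f := by
  have hα := continuous_toId (α := fun s => clamp (4 * s)) (by fun_prop)
  -- The intermediate map, the end r = 0 of `unwind`, runs through `f` on the first quarter and then
  -- rests at the base point. As the deformation starts at r = 1, the parameter is reversed by `σ`.
  refine Homotopic.trans (g := ⟨fun x => f (clamp (4 * x.1), x.2), by fun_prop⟩) ?_ ?_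
  · refine .intro (fun x => GottliebFox.unwind (fun s t => f (s, x.2.2.1, t)) (σ x.1) x.2.1 x.2.2.2)
      ?_ ?_ ?_ fun u => h.unwind (σ u)
    · exact (h.continuous_unwind f.continuous).comp
        (f := fun x : I × I × K × I => (σ x.1, x.2)) (by fun_prop)
    · rintro ⟨s, k, t⟩
      simp only [unitInterval.symm_zero]
      exact (glue_fold s t).symm
    · rintro ⟨s, k, t⟩
      simp only [unitInterval.symm_one]
      exact unwind_zero (fun t => h.base _ (.inr (.inl rfl))) s t
  · refine .intro (fun x => f (toId (fun s => clamp (4 * s)) x.1 x.2.1, x.2.2)) (by fun_prop) ?_ ?_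
      fun u => h.reparam_periodic (toId_left (by simp) u)
        (toId_right (clamp_of_one_le (by norm_num)) u)
    · rintro ⟨s, k, t⟩
      simp only [toId_zero]
      rfl
    · rintro ⟨s, k, t⟩
      simp only [toId_one]

section

variable {A B : Type u} [TopologicalSpace A] [TopologicalSpace B] {p : C(A, B)} {a : A}

/-- A periodic lift of a boxed map becomes boxed after folding, and folding changes the boxed map
only up to homotopy. -/
theorem Lifts.box_of_periodic (H : Λ.periodic.susp.Lifts p a) : Λ.box.susp.Lifts p a := by
  intro f hf
  obtain ⟨g, hg, hgf⟩ := H f hf.periodic_of_box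
  refine ⟨foldMap g hg, hg.fold, ?_⟩
  have := (hgf.fold (hg.comp p) hf.periodic_of_box).trans (homotopic_fold_of_box hf)
  convert this using 1
  exact ContinuousMap.ext fun x => map_fold (f := fun s t => g (s, x.2.1, t)) p x.1 x.2.2

/-- Extend the map constantly in t, lift, and restrict the lift and the homotopy to t = 0. -/
theorem Lifts.susp_of_periodic (H : Λ.periodic.susp.Lifts p a) : Λ.susp.Lifts p a := by
  intro f hf
  obtain ⟨g, hg, hgf⟩ := H ⟨fun x => f (x.1, x.2.1), by fun_prop⟩ hf.cylinder
  obtain ⟨F, hF, h0, h1, ha⟩ := hgf.elim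
  exact ⟨edgeMap g, hg.edge, .intro (fun x => F (x.1, x.2.1, x.2.2, 0)) (by fun_prop)
    (fun x => h0 _) (fun x => h1 _) fun u => (ha u).edge⟩

/-- Lift the fold and the edge separately and glue the two lifts. -/
theorem Lifts.periodic (H : Λ.box.susp.Lifts p a) (H' : Λ.susp.Lifts p a) :
    Λ.periodic.susp.Lifts p a := by
  intro f hf
  obtain ⟨G, hG, hGf⟩ := H (foldMap f hf) hf.fold
  obtain ⟨g, hg, hgf⟩ := H' (edgeMap f) hf.edge
  refine ⟨glueMap G g hG hg, hG.glue hg, ?_⟩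
  have := (hGf.glue hgf (hG.comp p) hf.fold (hg.comp p) hf.edge).trans (homotopic_glue_fold hf)
  convert this using 1
  exact ContinuousMap.ext fun x => 
    map_glue (f := fun s t => G (s, x.2.1, t)) p (fun s => g (s, x.2.1)) x.1 x.2.2

end

end Shape

/-! ### Cubes with boxed and periodic coordinates; the torus as a quotient -/

namespace Shape

theorem IsQuotient.of_bijective {K K' : Type*} {Λ' : Shape K'} {Λ : Shape K} {q : K' → K}
    (hq : q.Bijective) (hS : ∀ x, x ∈ Λ'.S ↔ q x ∈ Λ.S)
    (hr : ∀ x y, Λ'.r x y ↔ Λ.r (q x) (q y)) : IsQuotient Λ' Λ q where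
  mem_iff := hS
  map_rel x y h := .inr ((hr x y).1 h)
  lift_rel := by
    refine hq.surjective.forall₂.2 fun x y h => ⟨x, y, rfl, rfl, (hr x y).2 h⟩
  ker x y h := hq.injective h ▸ .refl _

/-- The shape on a cube in which the coordinates in `P` are periodic, and the other coordinates
have end points at which maps take the base point as value. -/
def cube (n : ℕ) (P : Set (Fin n)) : Shape (Fin n → I) where
  S := {y | ∃ i ∉ P, y i = 0 ∨ y i = 1}
  r x y := ∃ i ∈ P, x i = 0 ∧ y i = 1 ∧ ∀ j, j ≠ i → x j = y j

/-- The shape without conditions. -/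
def free (K : Type*) : Shape K where
  S := ∅
  r _ _ := False

theorem bijective_insertNth {n : ℕ} (i : Fin (n + 1)) :
    Function.Bijective fun x : (Fin n → I) × I => i.insertNth (α := fun _ => I) x.2 x.1 :=
  ((Equiv.prodComm _ _).trans (Fin.insertNthEquiv (fun _ => I) i)).bijective

theorem isQuotient_insertNth_periodic {n : ℕ} (i : Fin (n + 1)) {P : Set (Fin (n + 1))}
    (hi : i ∈ P) : IsQuotient (cube n (i.succAbove ⁻¹' P)).periodic (cube (n + 1) P)
      (fun x => i.insertNth (α := fun _ => I) x.2 x.1) := by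
  refine .of_bijective (bijective_insertNth i) ?_ ?_
  · rintro ⟨k, t⟩
    simp [cube, periodic, Fin.exists_iff_succAbove i, hi]
  · rintro ⟨k, t⟩ ⟨k', t'⟩
    simp [cube, periodic, Fin.exists_iff_succAbove i, Fin.forall_iff_succAbove i, hi, funext_iff]
    grind

theorem isQuotient_insertNth_box {n : ℕ} (i : Fin (n + 1)) {P : Set (Fin (n + 1))}
    (hi : i ∉ P) : IsQuotient (cube n (i.succAbove ⁻¹' P)).box (cube (n + 1) P)
      (fun x => i.insertNth (α := fun _ => I) x.2 x.1) := by
  refine .of_bijective (bijective_insertNth i) ?_ ?_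
  · rintro ⟨k, t⟩
    simp [cube, box, Fin.exists_iff_succAbove i, hi]
    grind
  · rintro ⟨k, t⟩ ⟨k', t'⟩
    simp [cube, box, Fin.exists_iff_succAbove i, Fin.forall_iff_succAbove i, hi]
    grind

/-- The loop coordinate is one more boxed coordinate, so loops over an n-cube represent π_{n+1}. -/
theorem isQuotient_cons (n : ℕ) : IsQuotient (cube n ∅).susp (cube (n + 1) ∅)
    (fun x => Fin.cons (α := fun _ => I) x.1 x.2) := by
  refine .of_bijective (Fin.consEquiv fun _ => I).bijective ?_ ?_
  · rintro ⟨k, t⟩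
    simp [cube, susp, Fin.exists_fin_succ, or_assoc]
  · rintro ⟨k, t⟩ ⟨k', t'⟩
    simp [cube, susp]

theorem coe_unitAddCircle_eq_iff {x y : I} : ((x : ℝ) : UnitAddCircle) = (y : ℝ) ↔
    x = y ∨ (x = 0 ∧ y = 1) ∨ (x = 1 ∧ y = 0) := by
  constructor
  · intro h
    obtain ⟨m, hm⟩ := (AddCircle.coe_eq_zero_iff (1 : ℝ) (x := x - y)).1
      (by rw [AddCircle.coe_sub, h, sub_self])
    rw [zsmul_eq_mul, mul_one] at hm
    have hx := x.2
    have hy := y.2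
    have h1 : m < 2 := by exact_mod_cast (show (m : ℝ) < 2 by linarith [hx.2, hy.1])
    have h2 : -2 < m := by exact_mod_cast (show (-2 : ℝ) < m by linarith [hx.1, hy.2])
    simp only [Subtype.ext_iff, Set.Icc.coe_zero, Set.Icc.coe_one]
    obtain rfl | rfl | rfl : m = -1 ∨ m = 0 ∨ m = 1 := by lia
    · push_cast at hm
      exact .inr (.inl ⟨by linarith [hx.1, hy.2], by linarith [hx.1, hy.2]⟩)
    · push_cast at hm
      exact .inl (by linarith)
    · push_cast at hm
      exact .inr (.inr ⟨by linarith [hx.2, hy.1], by linarith [hx.2, hy.1]⟩)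
  · rintro (rfl | ⟨rfl, rfl⟩ | ⟨rfl, rfl⟩) <;> simp [AddCircle.coe_period]

theorem surjective_torus (n : ℕ) :
    Function.Surjective fun (x : Fin n → I) (i : Fin n) => ((x i : ℝ) : UnitAddCircle) := by
  intro y
  have h : ∀ z : UnitAddCircle, ∃ x : I, ((x : ℝ) : UnitAddCircle) = z := fun z => by
    have hz : z ∈ ((↑) : ℝ → UnitAddCircle) '' Set.Icc (0 : ℝ) (0 + 1) := by
      rw [AddCircle.coe_image_Icc_eq]; trivial
    rw [zero_add] at hz
    obtain ⟨x, hx, rfl⟩ := hz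
    exact ⟨⟨x, hx⟩, rfl⟩
  choose x hx using h
  exact ⟨fun i => x (y i), funext fun i => hx _⟩

theorem isQuotient_torus (n : ℕ) : IsQuotient (cube n Set.univ) (free (Fin n → UnitAddCircle))
    (fun x i => ((x i : ℝ) : UnitAddCircle)) where
  mem_iff x := by simp [cube, free]
  map_rel := by
    rintro x y ⟨i, -, h0, h1, h⟩
    refine .inl (funext fun j => ?_)
    by_cases hj : j = i
    · subst hj
      exact coe_unitAddCircle_eq_iff.2 (.inr (.inl ⟨h0, h1⟩))
    · simp only [h j hj]
  lift_rel _ _ h := h.elim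
  ker := by
    -- `s` contains the coordinates in which the points may differ. They are corrected one at a
    -- time, each correction being trivial or an exchange of 0 and 1, that is, a generator or its
    -- inverse.
    have key : ∀ (s : Finset (Fin n)) (x y : Fin n → I),
        (∀ i, ((x i : ℝ) : UnitAddCircle) = (y i : ℝ)) → (∀ i ∉ s, x i = y i) →
          Relation.EqvGen (cube n Set.univ).r x y := by
      intro s
      induction s using Finset.induction_on with
      | empty =>
        intro x y _ h
        obtain rfl : x = y := funext fun i => h i (Finset.notMem_empty i)
        exact .refl _
      | insert i s _ ih =>
        intro x y hxy h
        refine .trans _ (Function.update x i (y i)) _ ?_ (ih _ _ (fun j => ?_) fun j hj => ?_)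
        · rcases coe_unitAddCircle_eq_iff.1 (hxy i) with h | ⟨h0, h1⟩ | ⟨h1, h0⟩
          · rw [← h, Function.update_eq_self]
            exact .refl _
          · exact .rel _ _ ⟨i, trivial, h0, by simpa using h1,
              fun j hj => (Function.update_of_ne hj _ _).symm⟩
          · exact .symm _ _ (.rel _ _ ⟨i, trivial, by simpa using h0, h1,
              fun j hj => Function.update_of_ne hj _ _⟩)
        · by_cases hj : j = i
          · subst hj
            simp
          · simpa [hj] using hxy j
        · by_cases hji : j = i
          · subst hji
            simp
          · simpa [hji] using h j (by simp [hji, hj])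
    exact fun x y h => key Finset.univ x y (fun i => congrFun h i) (by simp)

variable {A B : Type u} [TopologicalSpace A] [TopologicalSpace B] {p : C(A, B)} {a : A}

theorem IsQuotient.lifts_iff_of_compact {K K' : Type*} [TopologicalSpace K] [TopologicalSpace K']
    [CompactSpace K'] [T2Space K] {Λ' : Shape K'} {Λ : Shape K} {q : K' → K}
    (h : IsQuotient Λ' Λ q) (hq : q.Surjective) (hc : Continuous q) :
    Λ'.Lifts p a ↔ Λ.Lifts p a :=
  h.lifts_iff hq hc.isProperMap p a

theorem IsQuotient.susp_lifts_iff {K K' : Type*} [TopologicalSpace K] [TopologicalSpace K']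
    [CompactSpace K'] [T2Space K] {Λ' : Shape K'} {Λ : Shape K} {q : K' → K}
    (h : IsQuotient Λ' Λ q) (hq : q.Surjective) (hc : Continuous q) :
    Λ'.susp.Lifts p a ↔ Λ.susp.Lifts p a :=
  h.susp.lifts_iff_of_compact (Function.surjective_id.prodMap hq) (continuous_id.prodMap hc)

theorem cube_insert_lifts_iff {n : ℕ} {i : Fin (n + 1)} {P : Set (Fin (n + 1))} (hi : i ∉ P) :
    (cube (n + 1) (insert i P)).susp.Lifts p a ↔
      (cube (n + 1) P).susp.Lifts p a ∧ (cube n (i.succAbove ⁻¹' P)).susp.Lifts p a := by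
  have hc : Continuous fun x : (Fin n → I) × I => i.insertNth (α := fun _ => I) x.2 x.1 := by
    fun_prop
  have hs := (bijective_insertNth i).surjective
  have hP : i.succAbove ⁻¹' insert i P = i.succAbove ⁻¹' P := by
    ext j
    simp [Fin.succAbove_ne]
  rw [← (isQuotient_insertNth_periodic i (Set.mem_insert i P)).susp_lifts_iff hs hc,
    ← (isQuotient_insertNth_box i hi).susp_lifts_iff hs hc, hP]
  exact ⟨fun h => ⟨h.box_of_periodic, h.susp_of_periodic⟩, fun h => h.1.periodic h.2⟩

/-- Each new periodic coordinate calls on the case of one dimension less, so lifting is needed in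
all lower dimensions as well. -/
theorem cube_lifts_of_empty (H : ∀ n, (cube n ∅).susp.Lifts p a) (n : ℕ) (P : Set (Fin n)) :
    (cube n P).susp.Lifts p a := by
  induction n with
  | zero => exact Set.eq_empty_of_isEmpty P ▸ H 0
  | succ n ih =>
    induction P, P.toFinite using Set.Finite.induction_on with
    | empty => exact H _
    | insert hi _ h => exact (cube_insert_lifts_iff hi).2 ⟨h, ih _⟩

/-- Only the boxed half of `cube_insert_lifts_iff` is used, so the dimension stays fixed. -/
theorem cube_lifts_of_univ {n : ℕ} (H : (cube n Set.univ).susp.Lifts p a) (P : Set (Fin n)) :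
    (cube n Pᶜ).susp.Lifts p a := by
  cases n with
  | zero => rwa [Set.eq_univ_of_forall (s := Pᶜ) fun i => i.elim0]
  | succ n =>
    induction P, P.toFinite using Set.Finite.induction_on with
    | empty => rwa [Set.compl_empty]
    | @insert i P hi _ h =>
      have : Pᶜ = insert i (insert i P)ᶜ := by
        ext j
        by_cases hj : j = i
        · subst hj; simp [hi]
        · simp [hj]
      rw [this] at h
      exact ((cube_insert_lifts_iff (by simp)).1 h).1

theorem forall_lifts_iff : (∀ n, (cube (n + 1) ∅).Lifts p a) ↔
    ∀ n, (free (Fin n → UnitAddCircle)).susp.Lifts p a := by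
  have hS : ∀ n, (cube n ∅).susp.Lifts p a ↔ (cube (n + 1) ∅).Lifts p a := fun n =>
    (isQuotient_cons n).lifts_iff_of_compact (Fin.consEquiv fun _ => I).surjective (by fun_prop)
  have hT : ∀ n, (cube n Set.univ).susp.Lifts p a ↔
      (free (Fin n → UnitAddCircle)).susp.Lifts p a := fun n =>
    (isQuotient_torus n).susp_lifts_iff (surjective_torus n)
      (continuous_pi fun i => (AddCircle.continuous_mk' 1).comp (by fun_prop))
  simp only [← hS, ← hT]
  exact ⟨fun H n => cube_lifts_of_empty H n _, fun H n => by
    simpa using cube_lifts_of_univ (H n) Set.univ⟩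

end Shape

/-! ### Lifting as surjectivity on homotopy groups -/

variable {A B : Type u} [TopologicalSpace A] [TopologicalSpace B] {p : C(A, B)} {a : A} {b : B}

/-- Without periodic coordinates the relation is empty: admissible maps are the `GenLoop`s, and
admissible homotopies are homotopies relative to the boundary. -/
theorem surjective_homotopyGroupMap_iff (n : ℕ) (h : p a = b) :
    Function.Surjective (homotopyGroupMap (Fin (n + 1)) p h) ↔
      (Shape.cube (n + 1) ∅).Lifts p a := by
  subst h
  have hadm : ∀ {Z : Type u} {z : Z} {f : (Fin (n + 1) → I) → Z},
      (Shape.cube (n + 1) ∅).Adm z f ↔ ∀ y ∈ Cube.boundary (Fin (n + 1)), f y = z := by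
    intro Z z f
    refine ⟨fun hf y hy => hf.base y ?_, fun hf => ⟨fun y hy => hf y ?_, ?_⟩⟩
    · simpa [Shape.cube, Cube.boundary] using hy
    · simpa [Shape.cube, Cube.boundary] using hy
    · rintro x y ⟨i, hi, -⟩
      exact hi.elim
  constructor
  · intro H f hf
    obtain ⟨⟨g⟩, hg⟩ := H (Quotient.mk _ ⟨f, hadm.1 hf⟩)
    obtain ⟨F⟩ : GenLoop.Homotopic (genLoopMap (Fin (n + 1)) p rfl g) ⟨f, hadm.1 hf⟩ :=
      Quotient.exact hg
    refine ⟨g.1, hadm.2 g.2, .intro F F.continuous F.apply_zero F.apply_one fun u => hadm.2 ?_⟩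
    exact fun y hy => (F.prop' u y hy).trans (congrArg p (g.2 y hy))
  · rintro H ⟨f⟩
    obtain ⟨g, hg, hgf⟩ := H f.1 (hadm.2 f.2)
    obtain ⟨F, hF, h0, h1, ha⟩ := hgf.elim
    refine ⟨Quotient.mk _ ⟨g, hadm.1 hg⟩, Quotient.sound ?_⟩
    exact ⟨⟨⟨⟨F, hF⟩, h0, h1⟩, fun u y hy => (hadm.1 (ha u) y hy).trans
      (congrArg p (hadm.1 hg y hy)).symm⟩⟩

/-- Loops in the mapping space, and homotopies of them, correspond to maps on I × T and I × I × T by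
currying. Local compactness of `T` makes evaluation jointly continuous, as uncurrying requires. -/
theorem surjective_mapOfEq_postcomp_iff (T : Type) [TopologicalSpace T] [LocallyCompactSpace T]
    (h : p a = b) :
    Function.Surjective (FundamentalGroup.mapOfEq (postcomp T p)
      (x := ContinuousMap.const T a) (y := ContinuousMap.const T b)
      (ContinuousMap.ext fun _ => h)) ↔ (Shape.free T).susp.Lifts p a := by
  subst h
  have hadm : ∀ {Z : Type u} {z : Z} {f : I × T → Z}, (Shape.free T).susp.Adm z f ↔
      (∀ x, f (0, x) = z) ∧ ∀ x, f (1, x) = z := by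
    intro Z z f
    refine ⟨fun hf => ⟨fun x => hf.base _ (.inl rfl), fun x => hf.base _ (.inr (.inl rfl))⟩,
      fun hf => ⟨?_, ?_⟩⟩
    · rintro ⟨s, x⟩ (hs | hs | hx)
      · obtain rfl : s = 0 := hs
        exact hf.1 x
      · obtain rfl : s = 1 := hs
        exact hf.2 x
      · exact hx.elim
    · rintro x y ⟨-, hxy⟩
      exact hxy.elim
  constructor
  · intro H f hf
    let γ : Path (ContinuousMap.const T (p a)) (ContinuousMap.const T (p a)) :=
      ⟨f.curry, ContinuousMap.ext (hadm.1 hf).1, ContinuousMap.ext (hadm.1 hf).2⟩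
    obtain ⟨δ, hδ⟩ := H (Quotient.mk _ γ)
    induction δ using Path.Homotopic.Quotient.ind with | mk δ => ?_
    rw [FundamentalGroup.mapOfEq_apply] at hδ
    obtain ⟨F⟩ : (δ.map (postcomp T p).continuous).Homotopic γ := Quotient.exact hδ
    refine ⟨⟨fun x => δ x.1 x.2, ?_⟩, hadm.2 ⟨fun x => ?_, fun x => ?_⟩,
      .intro (fun x => F (x.1, x.2.1) x.2.2) ?_ ?_ ?_ fun u => hadm.2 ⟨fun x => ?_, fun x => ?_⟩⟩
    · exact (δ.continuous.comp continuous_fst).eval continuous_snd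
    · exact DFunLike.congr_fun δ.source x
    · exact DFunLike.congr_fun δ.target x
    · exact (F.continuous.comp (f := fun x : I × I × T => (x.1, x.2.1)) (by fun_prop)).eval
        (by fun_prop)
    · exact fun x => DFunLike.congr_fun (F.apply_zero x.1) x.2
    · exact fun x => DFunLike.congr_fun (F.apply_one x.1) x.2
    · exact DFunLike.congr_fun (Path.Homotopy.source F u) x
    · exact DFunLike.congr_fun (Path.Homotopy.target F u) x
  · intro H γ
    induction γ using Path.Homotopic.Quotient.ind with | mk γ => ?_
    obtain ⟨g, hg, hgf⟩ := H ⟨fun x => γ x.1 x.2, (γ.continuous.comp continuous_fst).eval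
      continuous_snd⟩ (hadm.2 ⟨DFunLike.congr_fun γ.source, DFunLike.congr_fun γ.target⟩)
    obtain ⟨F, hF, h0, h1, ha⟩ := hgf.elim
    let δ : Path (ContinuousMap.const T a) (ContinuousMap.const T a) :=
      ⟨g.curry, ContinuousMap.ext (hadm.1 hg).1, ContinuousMap.ext (hadm.1 hg).2⟩
    have hδ : (δ.map (postcomp T p).continuous).Homotopic γ := by
      refine ⟨⟨⟨(ContinuousMap.mk (fun x : (I × I) × T => F (x.1.1, x.1.2, x.2))
        (by fun_prop)).curry, fun s => ContinuousMap.ext fun x => h0 (s, x),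
        fun s => ContinuousMap.ext fun x => h1 (s, x)⟩, ?_⟩⟩
      rintro u s (rfl | rfl)
      · exact ContinuousMap.ext fun x => ((hadm.1 (ha u)).1 x).trans
          (congrArg p ((hadm.1 hg).1 x)).symm
      · exact ContinuousMap.ext fun x => ((hadm.1 (ha u)).2 x).trans
          (congrArg p ((hadm.1 hg).2 x)).symm
    refine ⟨Quotient.mk _ δ, ?_⟩
    exact (FundamentalGroup.mapOfEq_apply _ _ _).trans (Quotient.sound hδ)

/-- No hypothesis on the space `X` is needed. -/
theorem isGottlieb_iff_isGottliebFox {X : Type u} [TopologicalSpace X] (x₀ : X) :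
    IsGottlieb X x₀ ↔ IsGottliebFox X x₀ := by
  unfold IsGottlieb IsGottliebFox gottliebGroup gottliebFoxGroup
  simp only [MonoidHom.range_eq_top, surjective_homotopyGroupMap_iff]
  rw [Shape.forall_lifts_iff]
  exact forall_congr' fun n => (surjective_mapOfEq_postcomp_iff (Fin n → UnitAddCircle)
    (ev_id x₀)).symm

end GottliebFox

end

theorem proposition2p4 {X : Type*} [TopologicalSpace X] [CompactlyGeneratedSpace X] [T2Space X]
    [PathConnectedSpace X] (x₀ : X) :
    GottliebFox.IsGottlieb X x₀ ↔ GottliebFox.IsGottliebFox X x₀ :=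
  GottliebFox.isGottlieb_iff_isGottliebFox x₀
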